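/- Let $(\Omega,\mathcal F,\mathsf P)$ be a complete probability space and let $\mathsf H$ be a separable real Hilbert space. For $\mathsf x,\mathsf y,\mathsf z\in\mathsf H$ put $\mathsf H(\mathsf x,\mathsf y)=\{\mathsf u\in\mathsf H:\langle \mathsf u-\mathsf y,\mathsf x-\mathsf y\rangle\le 0\}$; let $\mathsf O(\mathsf x,\mathsf y,\mathsf z)=\mathsf H(\mathsf x,\mathsf y)\cap\mathsf H(\mathsf y,\mathsf z)$ if this intersection is nonempty and $\mathsf O(\mathsf x,\mathsf y,\mathsf z)=\{\mathsf y\}$ otherwise; and let $\mathsf Q(\mathsf x,\mathsf y,\mathsf z)=\mathrm{proj}_{\mathsf O(\mathsf x,\mathsf y,\mathsf z)}\mathsf x$. Let $(\mathsf K,\mathcal K)$ be a measurable space and let $(\mathsf T_{\mathsf k})_{\mathsf k\in\mathsf K}$ be a family of operators $\mathsf H\to\mathsf H$ such that $(\mathsf k,\mathsf x)\mapsto\mathsf T_{\mathsf k}\mathsf x$ is measurable from $(\mathsf K\times\mathsf H,\mathcal K\otimes\mathcal B_{\mathsf H})$ to $(\mathsf H,\mathcal B_{\mathsf H})$, where $\mathcal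 B_{\mathsf H}$ is the Borel $\sigma$-algebra of $\mathsf H$, and such that, for every $\mathsf k\in\mathsf K$: - $\mathsf T_{\mathsf k}$ is firmly quasinonexpansive: $\|\mathsf T_{\mathsf k}\mathsf x-\mathsf y\|^2+\|\mathsf T_{\mathsf k}\mathsf x-\mathsf x\|^2\le\|\mathsf x-\mathsf y\|^2$ for every $\mathsf x\in\mathsf H$ and every $\mathsf y\in\mathrm{Fix}\,\mathsf T_{\mathsf k}=\{\mathsf u\in\mathsf H:\mathsf T_{\mathsf k}\mathsf u=\mathsf u\}$; - $\mathsf{Id}-\mathsf T_{\mathsf k}$ is demiclosed at $0$: if $\mathsf u_n\rightharpoonup\mathsf x$ weakly and $\mathsf u_n-\mathsf T_{\mathsf k}\mathsf u_n\to0$ strongly, then $\mathsf T_{\mathsf k}\mathsf x=\mathsf x$. Let $k$ be a $\mathsf K$-valued random variable, suppose that $\mathsf Z=\{\mathsf z\in\mathsf H:\mathsf z\in\mathrm{Fix}\,\mathsf T_k\ \text{almost surely}\}\neq\varnothing$, and let $x_0\in L^2(\Omega,\mathcal F,\mathsf P;\mathsf H)$. Let $M\ge1$ be an integer, $\delta\in(0,1/M)$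 and $\varepsilon\in(0,1)$. For $n=0,1,\dots$, the following is iterated: 1. for $i=1,\dots,M$, $k_{i,n}$ is a random variable with the same distribution as $k$ that is independent of $\sigma(x_0,\dots,x_n)$, and $p_{i,n}=\mathsf T_{k_{i,n}}x_n$; 2. $\beta_{1,n},\dots,\beta_{M,n}$ are $[0,1]$-valued random variables such that, almost surely, $\sum_{i=1}^M\beta_{i,n}=1$ and, for every $i$, $\beta_{i,n}\ge\delta$ whenever $\|p_{i,n}-x_n\|=\max_{1\le j\le M}\|p_{j,n}-x_n\|$; 3. $p_n=\sum_{i=1}^M\beta_{i,n}p_{i,n}$, and $a_n=x_n+L_n(p_n-x_n)$ with $$L_n=\frac{\sum_{i=1}^M\beta_{i,n}\|p_{i,n}-x_n\|^2+1_{[p_n=x_n]}}{\|p_n-x_n\|^2+1_{[p_n=x_n]}};$$ 4. $\lambda_n$ is an $[\varepsilon,1]$-valued random variable, $r_n=x_n+\lambda_n(a_n-x_n)$, and $x_{n+1}=\mathsf Q(x_0,x_n,r_n)$. Then $\mathsf Z$ is closed and convex (so that $\mathrm{proj}_{\mathsf Z}$ is well defined), every $x_n$ and $\mathrm{proj}_{\mathsf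 Z}x_0$ belong to $L^2(\Omega,\mathcal F,\mathsf P;\mathsf H)$, and $(x_n)_{n\in\mathbb N}$ converges to $\mathrm{proj}_{\mathsf Z}x_0$ strongly in $\mathsf H$ almost surely and strongly in $L^2(\Omega,\mathcal F,\mathsf P;\mathsf H)$. -/

import Mathlib

open MeasureTheory ProbabilityTheory Filter Topology
open scoped ENNReal RealInnerProductSpace

section HilbertSpace

variable {H : Type*} [NormedAddCommGroup H] [InnerProductSpace ℝ H]

/-- `T` is firmly quasinonexpansive. -/
def FirmlyQuasinonexpansive (T : H → H) : Prop :=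
  ∀ x : H, ∀ y ∈ Function.fixedPoints T, ‖T x - y‖ ^ 2 + ‖T x - x‖ ^ 2 ≤ ‖x - y‖ ^ 2

/-- `T` is demiclosed at `y`: whenever `u n` converges weakly to `x` and `T (u n)` converges
strongly to `y`, one has `T x = y`. -/
def DemiclosedAt (T : H → H) (y : H) : Prop :=
  ∀ (x : H) (u : ℕ → H),
    Tendsto (fun n => toWeakSpace ℝ H (u n)) atTop (𝓝 (toWeakSpace ℝ H x)) →
    Tendsto (fun n => T (u n)) atTop (𝓝 y) → T x = y

/-- `p` is a point of `C` at minimal distance from `x`. -/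
def IsBestApprox (C : Set H) (x p : H) : Prop :=
  p ∈ C ∧ ∀ y ∈ C, ‖x - p‖ ≤ ‖x - y‖

open Classical in
/-- The projection of `x` onto `C`. It is the unique nearest point of `C` when `C` is nonempty,
closed and convex (see `projOnto_spec` and `IsBestApprox.unique`); the default value `x` is used
only if there is no nearest point. -/
noncomputable def projOnto (C : Set H) (x : H) : H :=
  if h : ∃ p, IsBestApprox C x p then h.choose else x

theorem IsBestApprox.unique {C : Set H} (hC : Convex ℝ C) {x p q : H}
    (hp : IsBestApprox C x p) (hq : IsBestApprox C x q) : p = q := by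
  have hm : (1 / 2 : ℝ) • p + (1 / 2 : ℝ) • q ∈ C :=
    hC hp.1 hq.1 (by norm_num) (by norm_num) (by norm_num)
  have h1 := hp.2 _ hm
  have h2 : ‖x - p‖ = ‖x - q‖ := le_antisymm (hp.2 _ hq.1) (hq.2 _ hp.1)
  have h3 := parallelogram_law_with_norm ℝ (x - p) (x - q)
  have h4 : (x - p) + (x - q) = (2 : ℝ) • (x - ((1 / 2 : ℝ) • p + (1 / 2 : ℝ) • q)) := by
    module
  have h5 : (x - p) - (x - q) = q - p := by abel
  rw [h4, h5, norm_smul, ← h2, Real.norm_of_nonneg (by norm_num : (0 : ℝ) ≤ 2)] at h3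
  have h6 : ‖q - p‖ = 0 := by
    nlinarith [norm_nonneg (x - p), norm_nonneg (q - p), mul_self_le_mul_self (norm_nonneg _) h1]
  exact (sub_eq_zero.mp (norm_eq_zero.mp h6)).symm

theorem projOnto_spec [CompleteSpace H] {C : Set H} (hne : C.Nonempty) (hcl : IsClosed C)
    (hC : Convex ℝ C) (x : H) : IsBestApprox C x (projOnto C x) := by
  have h : ∃ p, IsBestApprox C x p := by
    obtain ⟨v, hv, hvx⟩ := exists_norm_eq_iInf_of_complete_convex hne hcl.isComplete hC x
    refine ⟨v, hv, fun y hy => ?_⟩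
    rw [hvx]
    exact ciInf_le ⟨0, Set.forall_mem_range.2 fun _ => norm_nonneg _⟩ (⟨y, hy⟩ : C)
  rw [projOnto, dif_pos h]
  exact h.choose_spec

/-- The half-space (or the whole space, if `x = y`) `H(x, y)` onto which `x` projects to `y`. -/
def haugazeauHalfSpace (x y : H) : Set H :=
  {z | ⟪z - y, x - y⟫ ≤ 0}

open Classical in
/-- The outer approximation `O(x, y, z)`. -/
noncomputable def haugazeauOuter (x y z : H) : Set H :=
  if (haugazeauHalfSpace x y ∩ haugazeauHalfSpace y z).Nonempty then
    haugazeauHalfSpace x y ∩ haugazeauHalfSpace y z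
  else {y}

/-- `Q(x, y, z)`, the projection of `x` onto `O(x, y, z)`. -/
noncomputable def haugazeauQ (x y z : H) : H :=
  projOnto (haugazeauOuter x y z) x

theorem haugazeauHalfSpace_isClosed (x y : H) : IsClosed (haugazeauHalfSpace x y) :=
  isClosed_le (by fun_prop) continuous_const

theorem haugazeauHalfSpace_convex (x y : H) : Convex ℝ (haugazeauHalfSpace x y) := by
  intro u hu v hv a b ha hb hab
  simp only [haugazeauHalfSpace, Set.mem_ofPred_eq] at hu hv ⊢
  have h : a • u + b • v - y = a • (u - y) + b • (v - y) := by
    have hy : y = (a + b) • y := by rw [hab, one_smul]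
    nth_rewrite 1 [hy]
    module
  rw [h, inner_add_left, real_inner_smul_left, real_inner_smul_left]
  nlinarith

/-- `Q(x, y, z)` really is the nearest point to `x` in `O(x, y, z)`. -/
theorem haugazeauQ_spec [CompleteSpace H] (x y z : H) :
    IsBestApprox (haugazeauOuter x y z) x (haugazeauQ x y z) := by
  unfold haugazeauQ haugazeauOuter
  split_ifs with h
  · exact projOnto_spec h
      ((haugazeauHalfSpace_isClosed x y).inter (haugazeauHalfSpace_isClosed y z))
      ((haugazeauHalfSpace_convex x y).inter (haugazeauHalfSpace_convex y z)) x
  · exact projOnto_spec (Set.singleton_nonempty y) isClosed_singleton (convex_singleton y) x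

/-- The weighted average `p = ∑ i, β i • q i` of the points `q i`. -/
noncomputable def blockAverage {M : ℕ} (β : Fin M → ℝ) (q : Fin M → H) : H :=
  ∑ i, β i • q i

open Classical in
/-- The extrapolation parameter
`L = (∑ i, β i * ‖q i - x‖ ^ 2 + 1_[p = x]) / (‖p - x‖ ^ 2 + 1_[p = x])`, with
`p = ∑ i, β i • q i`. -/
noncomputable def extrapolation {M : ℕ} (β : Fin M → ℝ) (q : Fin M → H) (x : H) : ℝ :=
  (∑ i, β i * ‖q i - x‖ ^ 2 + if blockAverage β q = x then 1 else 0) /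
    (‖blockAverage β q - x‖ ^ 2 + if blockAverage β q = x then 1 else 0)

/-- The extrapolated point `a = x + L (p - x)`. -/
noncomputable def extrapolatedPoint {M : ℕ} (β : Fin M → ℝ) (q : Fin M → H) (x : H) : H :=
  x + extrapolation β q x • (blockAverage β q - x)

/-- The relaxed point `r = x + lam (a - x)`. -/
noncomputable def relaxedPoint {M : ℕ} (β : Fin M → ℝ) (q : Fin M → H) (lam : ℝ) (x : H) : H :=
  x + lam • (extrapolatedPoint β q x - x)

end HilbertSpace

section Random

variable {Ω K H : Type*}

/-- The set `Z` of the points that are almost surely fixed by the random operator `T k`. -/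
def asFixedPoints [MeasurableSpace Ω] (P : Measure Ω) (T : K → H → H) (k : Ω → K) : Set H :=
  {z | ∀ᵐ ω ∂P, z ∈ Function.fixedPoints (T (k ω))}

/-- The `σ`-algebra generated by `x 0, …, x n`. -/
abbrev pastSigma [MeasurableSpace H] (x : ℕ → Ω → H) (n : ℕ) : MeasurableSpace Ω :=
  ⨆ j : ℕ, ⨆ _ : j ≤ n, MeasurableSpace.comap (x j) inferInstance

/-- `x` is a sequence generated, from its initial point `x 0`, by the randomly activated
block-iterative extrapolated Haugazeau algorithm with blocks of size `M`; the activated indices at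
iteration `n` are `kk n i`, the weights are `β n i`, and the relaxation parameter is `lam n`. -/
structure IsBlockHaugazeau [MeasurableSpace Ω] [MeasurableSpace K]
    [NormedAddCommGroup H] [InnerProductSpace ℝ H] [MeasurableSpace H]
    (P : Measure Ω) (T : K → H → H) (k : Ω → K) (M : ℕ) (δ ε : ℝ)
    (kk : ℕ → Fin M → Ω → K) (β : ℕ → Fin M → Ω → ℝ) (lam : ℕ → Ω → ℝ)
    (x : ℕ → Ω → H) : Prop where
  /-- the indices are random variables -/
  index_measurable : ∀ n i, Measurable (kk n i)
  /-- each index is a copy of `k` -/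
  index_copy : ∀ n i, IdentDistrib (kk n i) k P P
  /-- each index is independent of the past of the sequence -/
  index_indep : ∀ n i,
    Indep (MeasurableSpace.comap (kk n i) inferInstance) (pastSigma x n) P
  /-- the weights are random variables -/
  weight_measurable : ∀ n i, Measurable (β n i)
  weight_mem : ∀ n i, ∀ᵐ ω ∂P, β n i ω ∈ Set.Icc (0 : ℝ) 1
  weight_sum : ∀ n, ∀ᵐ ω ∂P, ∑ i, β n i ω = 1
  /-- the weight is at least `δ` at every index which realizes the largest displacement -/
  weight_ge : ∀ n i, ∀ᵐ ω ∂P,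
    (∀ j, ‖T (kk n j ω) (x n ω) - x n ω‖ ≤ ‖T (kk n i ω) (x n ω) - x n ω‖) → δ ≤ β n i ω
  /-- the relaxation parameters are random variables -/
  relax_measurable : ∀ n, Measurable (lam n)
  relax_mem : ∀ n, ∀ᵐ ω ∂P, lam n ω ∈ Set.Icc ε 1
  /-- the iteration `x (n + 1) = Q (x 0) (x n) (r n)` -/
  update : ∀ n, ∀ᵐ ω ∂P, x (n + 1) ω = haugazeauQ (x 0 ω) (x n ω)
    (relaxedPoint (fun i => β n i ω) (fun i => T (kk n i ω) (x n ω)) (lam n ω) (x n ω))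

end Random

/-! ### Firmly quasinonexpansive operators, nearest points, and the projection onto two half-spaces.
-/

section Deterministic

variable {H : Type*} [NormedAddCommGroup H] [InnerProductSpace ℝ H]

/-! Fix a path. The cut through `r n` never removes a point of `Z`, so inductively `x n` is the
point nearest to `x 0` in a convex set containing `Z`. Hence `‖x 0 - x n‖` is at most the distance
from `x 0` to `Z`, and `∑ ‖r n - x n‖ ^ 2` is at most its square (`norm_initial_sub_le`,
`sum_norm_sq_relaxed_le`). By the weight condition, each cut dominates every displacement in its
block up to the factor `δ * ε ^ 2` (`IsBlockHaugazeau.ae_step`).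

Taking expectations, independence replaces the activated index by a fresh copy of `k` on a second
probability factor (`ae_ae_tsum_lt_top_of_indepFun`). So for almost every `ω`, the whole path
satisfies `x n ω - T (k ω') (x n ω) → 0` for almost every `ω'`. Demiclosedness then puts every weak
cluster point in `Z`, and the distance bound makes the convergence strong
(`tendsto_projOnto_of_weak_cluster`). The same bound gives an `L²` majorant. -/

theorem mem_haugazeauHalfSpace {x y z : H} : z ∈ haugazeauHalfSpace x y ↔ ⟪z - y, x - y⟫ ≤ 0 :=
  Iff.rfl

/-- The fixed point set of a firmly quasinonexpansive operator is an intersection of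
half-spaces. -/
theorem FirmlyQuasinonexpansive.fixedPoints_eq {T : H → H} (hT : FirmlyQuasinonexpansive T) :
    Function.fixedPoints T = ⋂ x, haugazeauHalfSpace x (T x) := by
  ext y
  simp only [Set.mem_iInter, mem_haugazeauHalfSpace]
  constructor
  · intro hy x
    have h := hT x y hy
    have e : x - y = (x - T x) - (y - T x) := by abel
    rw [e, norm_sub_sq_real (x - T x), norm_sub_rev (T x) y, norm_sub_rev (T x) x,
      real_inner_comm] at h
    linarith
  · intro h
    -- Testing with the point itself leaves `‖y - T y‖ ^ 2 ≤ 0`.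
    have h1 := h y
    rw [real_inner_self_nonpos, sub_eq_zero] at h1
    exact h1.symm

theorem FirmlyQuasinonexpansive.isClosed_fixedPoints {T : H → H}
    (hT : FirmlyQuasinonexpansive T) : IsClosed (Function.fixedPoints T) := by
  rw [hT.fixedPoints_eq]
  exact isClosed_iInter fun x => haugazeauHalfSpace_isClosed _ _

theorem FirmlyQuasinonexpansive.convex_fixedPoints {T : H → H}
    (hT : FirmlyQuasinonexpansive T) : Convex ℝ (Function.fixedPoints T) := by
  rw [hT.fixedPoints_eq]
  exact convex_iInter fun x => haugazeauHalfSpace_convex _ _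

/-- The right side is linear in the displacement, so this form survives averaging over a block. -/
theorem FirmlyQuasinonexpansive.norm_sq_le_inner {T : H → H} (hT : FirmlyQuasinonexpansive T)
    {y : H} (hy : y ∈ Function.fixedPoints T) (x : H) : ‖T x - x‖ ^ 2 ≤ ⟪y - x, T x - x⟫ := by
  rw [hT.fixedPoints_eq] at hy
  have h := mem_haugazeauHalfSpace.1 (Set.mem_iInter.1 hy x)
  have e1 : y - T x = (y - x) - (T x - x) := by abel
  have e2 : x - T x = -(T x - x) := by abel
  rw [e1, e2, inner_neg_right, inner_sub_left, real_inner_self_eq_norm_sq] at h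
  linarith

theorem isBestApprox_of_inner_nonpos {C : Set H} {x p : H} (hp : p ∈ C)
    (h : ∀ y ∈ C, ⟪x - p, y - p⟫ ≤ 0) : IsBestApprox C x p := by
  refine ⟨hp, fun y hy => ?_⟩
  have e : x - y = (x - p) - (y - p) := by abel
  have h1 := norm_sub_sq_real (x - p) (y - p)
  rw [← e] at h1
  refine le_of_sq_le_sq ?_ (norm_nonneg _)
  nlinarith [h y hy, sq_nonneg ‖y - p‖]

theorem IsBestApprox.inner_nonpos {C : Set H} (hC : Convex ℝ C) {x p : H}
    (hp : IsBestApprox C x p) {y : H} (hy : y ∈ C) : ⟪x - p, y - p⟫ ≤ 0 := by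
  refine (norm_eq_iInf_iff_real_inner_le_zero hC hp.1).1 ?_ y hy
  have : Nonempty C := ⟨⟨p, hp.1⟩⟩
  exact le_antisymm (le_ciInf fun w => hp.2 _ w.2)
    (ciInf_le ⟨0, Set.forall_mem_range.2 fun _ => norm_nonneg _⟩ (⟨p, hp.1⟩ : C))

theorem IsBestApprox.projOnto_eq {C : Set H} (hC : Convex ℝ C) {x p : H}
    (hp : IsBestApprox C x p) : projOnto C x = p := by
  have h : ∃ p, IsBestApprox C x p := ⟨p, hp⟩
  rw [projOnto, dif_pos h]
  exact h.choose_spec.unique hC hp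

/-- Add the two variational inequalities and apply Cauchy–Schwarz. It serves to make the limit
measurable. -/
theorem lipschitzWith_projOnto [CompleteSpace H] {C : Set H} (hne : C.Nonempty)
    (hcl : IsClosed C) (hC : Convex ℝ C) : LipschitzWith 1 (projOnto C) := by
  refine LipschitzWith.of_dist_le_mul fun x y => ?_
  have hx := projOnto_spec hne hcl hC x
  have hy := projOnto_spec hne hcl hC y
  set p := projOnto C x
  set q := projOnto C y
  have h1 := hx.inner_nonpos hC hy.1
  have h2 := hy.inner_nonpos hC hx.1
  have h3 : ⟪x - p, q - p⟫ + ⟪y - q, p - q⟫ = ‖p - q‖ ^ 2 - ⟪x - y, p - q⟫ := by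
    have e1 : q - p = -(p - q) := by abel
    rw [e1, inner_neg_right, ← real_inner_self_eq_norm_sq, neg_add_eq_sub, ← inner_sub_left,
      ← inner_sub_left]
    congr 1
    abel
  have h4 := real_inner_le_norm (x - y) (p - q)
  rw [dist_eq_norm, dist_eq_norm, NNReal.coe_one, one_mul]
  by_contra! hlt
  nlinarith [norm_nonneg (x - y), norm_nonneg (p - q)]

section Haugazeau

open Classical in
/-- An explicit expression for `haugazeauQ`. -/
noncomputable def haugazeauFormula (x y z : H) : H :=
  if ‖x - y‖ ^ 2 * ‖y - z‖ ^ 2 - ⟪x - y, y - z⟫ ^ 2 ≤ 0 then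
    if 0 ≤ ⟪x - y, y - z⟫ then z else y
  else if ‖x - y‖ ^ 2 * ‖y - z‖ ^ 2 - ⟪x - y, y - z⟫ ^ 2 ≤ ⟪x - y, y - z⟫ * ‖y - z‖ ^ 2 then
    x - (1 + ⟪x - y, y - z⟫ / ‖y - z‖ ^ 2) • (y - z)
  else
    y + (‖y - z‖ ^ 2 / (‖x - y‖ ^ 2 * ‖y - z‖ ^ 2 - ⟪x - y, y - z⟫ ^ 2)) •
      (⟪x - y, y - z⟫ • (x - y) - ‖x - y‖ ^ 2 • (y - z))

/-- The squared norm of the difference of the two sides is `‖b‖ ^ 2` times the Gram determinant. -/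
theorem collinear_of_gram_nonpos {a b : H} (h : ‖a‖ ^ 2 * ‖b‖ ^ 2 - ⟪a, b⟫ ^ 2 ≤ 0) :
    ‖b‖ ^ 2 • a = ⟪a, b⟫ • b := by
  rw [← sub_eq_zero, ← norm_eq_zero, ← sq_eq_zero_iff]
  refine le_antisymm ?_ (sq_nonneg _)
  rw [norm_sub_sq_real, norm_smul, norm_smul, real_inner_smul_left, real_inner_smul_right,
    mul_pow, mul_pow, Real.norm_eq_abs, Real.norm_eq_abs, sq_abs, sq_abs]
  nlinarith [sq_nonneg ‖b‖]

/-- The Karush-Kuhn-Tucker conditions for the projection onto the intersection of the two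
half-spaces `H(x, y)` and `H(y, z)`. -/
theorem isBestApprox_inter_of_multipliers {x y z p : H} {s t : ℝ} (hs : 0 ≤ s) (ht : 0 ≤ t)
    (hp : x - p = s • (x - y) + t • (y - z)) (h1 : ⟪p - y, x - y⟫ ≤ 0)
    (h1' : s * ⟪p - y, x - y⟫ = 0) (h2 : ⟪p - z, y - z⟫ = 0) :
    IsBestApprox (haugazeauHalfSpace x y ∩ haugazeauHalfSpace y z) x p := by
  refine isBestApprox_of_inner_nonpos ⟨h1, h2.le⟩ fun v hv => ?_
  have hv1 := mem_haugazeauHalfSpace.1 hv.1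
  have hv2 := mem_haugazeauHalfSpace.1 hv.2
  have e1 : v - p = (v - y) - (p - y) := by abel
  have e2 : ⟪y - z, v - p⟫ = ⟪v - z, y - z⟫ - ⟪p - z, y - z⟫ := by
    rw [← inner_sub_left, real_inner_comm]
    congr 1
    abel
  rw [hp, inner_add_left, real_inner_smul_left, real_inner_smul_left, e2, e1, inner_sub_right,
    real_inner_comm (v - y), real_inner_comm (p - y), h2]
  nlinarith [mul_nonneg hs (neg_nonneg.2 hv1), mul_nonneg ht (neg_nonneg.2 hv2)]

theorem haugazeauQ_eq_formula [CompleteSpace H] (x y z : H) :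
    haugazeauQ x y z = haugazeauFormula x y z := by
  have key : ∀ p, IsBestApprox (haugazeauHalfSpace x y ∩ haugazeauHalfSpace y z) x p →
      haugazeauQ x y z = p := by
    intro p hp
    rw [haugazeauQ, haugazeauOuter, if_pos ⟨p, hp.1⟩]
    exact hp.projOnto_eq
      ((haugazeauHalfSpace_convex x y).inter (haugazeauHalfSpace_convex y z))
  have hzy : ∀ v : H, v - z = (v - y) + (y - z) := fun v => by abel
  unfold haugazeauFormula
  set χ := ⟪x - y, y - z⟫ with hχ
  have hχ' : ⟪y - z, x - y⟫ = χ := real_inner_comm _ _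
  set μ := ‖x - y‖ ^ 2 with hμ
  set ν := ‖y - z‖ ^ 2 with hν
  have haa : ⟪x - y, x - y⟫ = μ := real_inner_self_eq_norm_sq _
  have hbb : ⟪y - z, y - z⟫ = ν := real_inner_self_eq_norm_sq _
  have hν0 : 0 ≤ ν := sq_nonneg _
  have hμ0 : 0 ≤ μ := sq_nonneg _
  -- The cases: collinear with nonempty intersection; collinear with empty intersection; only the
  -- second constraint needed; both active.
  split_ifs with h1 h2 h2
  · have hcol : ν • (x - y) = χ • (y - z) := collinear_of_gram_nonpos h1
    apply key
    rcases hν0.eq_or_lt with h0 | hpos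
    · have hb : y - z = 0 := by
        rw [← norm_eq_zero, ← sq_eq_zero_iff]
        exact h0.symm
      have hyz : y = z := sub_eq_zero.1 hb
      subst hyz
      exact isBestApprox_inter_of_multipliers zero_le_one le_rfl (by simp) (by simp) (by simp)
        (by simp)
    · have ha : x - y = (χ / ν) • (y - z) := by
        rw [div_eq_inv_mul, mul_smul, ← hcol, smul_smul, inv_mul_cancel₀ hpos.ne', one_smul]
      refine isBestApprox_inter_of_multipliers (s := 0) (t := χ / ν + 1) le_rfl (by positivity)
        ?_ ?_ (by simp) (by simp)
      · rw [hzy x, ha]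
        module
      · have e : z - y = -(y - z) := by abel
        rw [e, inner_neg_left, hχ']
        linarith
  · have hcol : ν • (x - y) = χ • (y - z) := collinear_of_gram_nonpos h1
    have hempty : ¬ (haugazeauHalfSpace x y ∩ haugazeauHalfSpace y z).Nonempty := by
      rintro ⟨v, hv1, hv2⟩
      rw [mem_haugazeauHalfSpace] at hv1 hv2
      rw [hzy v, inner_add_left, hbb] at hv2
      -- The left side is nonpositive, while the right is a product of two negative numbers.
      have h3 : ν * ⟪v - y, x - y⟫ = χ * ⟪v - y, y - z⟫ := by
        rw [← real_inner_smul_right, ← real_inner_smul_right, hcol]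
      have hpos : 0 < ν := by
        rcases hν0.eq_or_lt with h0 | hpos
        · have hb : y - z = 0 := by
            rw [← norm_eq_zero, ← sq_eq_zero_iff]
            exact h0.symm
          exact absurd (by rw [hχ, hb, inner_zero_right]) h2
        · exact hpos
      nlinarith
    rw [haugazeauQ, haugazeauOuter, if_neg hempty]
    exact (isBestApprox_of_inner_nonpos (Set.mem_singleton y) (by simp)).projOnto_eq (convex_singleton y)
  · push Not at h1
    have hpos : 0 < ν := by
      rcases hν0.eq_or_lt with h0 | hpos
      · exfalso
        rw [← h0] at h1
        nlinarith [sq_nonneg χ]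
      · exact hpos
    have hχ0 : 0 ≤ χ := by
      by_contra! h
      nlinarith
    apply key
    refine isBestApprox_inter_of_multipliers (s := 0) (t := 1 + χ / ν) le_rfl (by positivity)
      (by module) ?_ (by simp) ?_
    · have e : x - (1 + χ / ν) • (y - z) - y = (x - y) - (1 + χ / ν) • (y - z) := by abel
      rw [e, inner_sub_left, real_inner_smul_left, haa, hχ']
      have : μ - (1 + χ / ν) * χ = (μ * ν - χ ^ 2 - χ * ν) / ν := by field_simp; ring
      rw [this]
      exact div_nonpos_of_nonpos_of_nonneg (by linarith) hν0
    · have e : x - (1 + χ / ν) • (y - z) - z = (x - y) - (χ / ν) • (y - z) := by module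
      rw [e, inner_sub_left, real_inner_smul_left, hbb, ← hχ]
      field_simp
      ring
  · push Not at h1 h2
    set ρ := μ * ν - χ ^ 2 with hρ
    have hρ0 : ρ ≠ 0 := h1.ne'
    have e1 : y + (ν / ρ) • (χ • (x - y) - μ • (y - z)) - y
        = (ν / ρ) • (χ • (x - y) - μ • (y - z)) := by abel
    have e2 : ⟪y + (ν / ρ) • (χ • (x - y) - μ • (y - z)) - y, x - y⟫ = 0 := by
      rw [e1, real_inner_smul_left, inner_sub_left, real_inner_smul_left, real_inner_smul_left,
        haa, hχ']
      ring
    apply key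
    -- The multipliers are the coefficients of `x - p` on `x - y` and `y - z`; the failed test `ρ ≤
    -- χ * ν` makes `s` nonnegative.
    refine isBestApprox_inter_of_multipliers (s := (ρ - χ * ν) / ρ) (t := ν * μ / ρ)
      (div_nonneg (by linarith) h1.le) (by positivity) ?_ e2.le (by rw [e2, mul_zero]) ?_
    · have e3 : (ρ - χ * ν) / ρ = 1 - (ν / ρ) * χ := by field_simp
      have e4 : ν * μ / ρ = (ν / ρ) * μ := by ring
      rw [e3, e4]
      module
    · rw [hzy, e1, inner_add_left, real_inner_smul_left, inner_sub_left, real_inner_smul_left,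
        real_inner_smul_left, hbb, ← hχ]
      have : ν / ρ * (χ * χ - μ * ν) = - ν * (ρ / ρ) := by rw [hρ]; ring
      rw [this, div_self hρ0]
      ring

theorem haugazeauQ_mem_inter [CompleteSpace H] {x y z : H}
    (h : (haugazeauHalfSpace x y ∩ haugazeauHalfSpace y z).Nonempty) :
    IsBestApprox (haugazeauHalfSpace x y ∩ haugazeauHalfSpace y z) x (haugazeauQ x y z) := by
  have h1 := haugazeauQ_spec x y z
  rwa [haugazeauOuter, if_pos h] at h1

end Haugazeau

end Deterministic

/-! ### Averaging, extrapolation and relaxation of a block. -/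

section BlockStep

variable {H : Type*} [NormedAddCommGroup H] [InnerProductSpace ℝ H]

theorem blockAverage_sub {M : ℕ} {β : Fin M → ℝ} (hsum : ∑ i, β i = 1) (q : Fin M → H) (x : H) :
    blockAverage β q - x = ∑ i, β i • (q i - x) := by
  simp_rw [smul_sub, Finset.sum_sub_distrib]
  rw [← Finset.sum_smul, hsum, one_smul, blockAverage]

/-- Convexity of the squared norm; it makes the extrapolation parameter at least 1. -/
theorem norm_sq_blockAverage_sub_le {M : ℕ} {β : Fin M → ℝ} (h0 : ∀ i, 0 ≤ β i)
    (hsum : ∑ i, β i = 1) (q : Fin M → H) (x : H) :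
    ‖blockAverage β q - x‖ ^ 2 ≤ ∑ i, β i * ‖q i - x‖ ^ 2 := by
  set m := blockAverage β q - x with hm
  have h1 : ‖m‖ ^ 2 = ∑ i, β i * ⟪q i - x, m⟫ := by
    rw [← real_inner_self_eq_norm_sq]
    nth_rewrite 1 [hm]
    rw [blockAverage_sub hsum, sum_inner]
    simp_rw [real_inner_smul_left]
  have h2 : ∑ i, β i * ⟪q i - x, m⟫ ≤ ∑ i, β i * (‖q i - x‖ ^ 2 / 2 + ‖m‖ ^ 2 / 2) := by
    refine Finset.sum_le_sum fun i _ => mul_le_mul_of_nonneg_left ?_ (h0 i)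
    nlinarith [real_inner_le_norm (q i - x) m, sq_nonneg (‖q i - x‖ - ‖m‖)]
  simp_rw [mul_add, Finset.sum_add_distrib, ← mul_div_assoc] at h2
  rw [← Finset.sum_div, ← Finset.sum_div, ← Finset.sum_mul, hsum, one_mul] at h2
  linarith

/-- Let `S` be the weighted sum and `L` the extrapolation parameter. Off the degenerate case, `L *
‖p - x‖ ^ 2 = S`, so the middle term equals `L * S`; both bounds follow from `L ≥ 1` and `S ≤ ⟪z -
x, p - x⟫`. -/
theorem extrapolatedPoint_estimates {M : ℕ} {β : Fin M → ℝ} (h0 : ∀ i, 0 ≤ β i)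
    (hsum : ∑ i, β i = 1) {q : Fin M → H} {x z : H}
    (hz : ∀ i, ‖q i - x‖ ^ 2 ≤ ⟪z - x, q i - x⟫) :
    ∑ i, β i * ‖q i - x‖ ^ 2 ≤ ‖extrapolatedPoint β q x - x‖ ^ 2 ∧
      ‖extrapolatedPoint β q x - x‖ ^ 2 ≤ ⟪z - x, extrapolatedPoint β q x - x⟫ := by
  have hS0 : 0 ≤ ∑ i, β i * ‖q i - x‖ ^ 2 :=
    Finset.sum_nonneg fun i _ => mul_nonneg (h0 i) (sq_nonneg _)
  have hSz : ∑ i, β i * ‖q i - x‖ ^ 2 ≤ ⟪z - x, blockAverage β q - x⟫ := by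
    rw [blockAverage_sub hsum, inner_sum]
    simp_rw [real_inner_smul_right]
    exact Finset.sum_le_sum fun i _ => mul_le_mul_of_nonneg_left (hz i) (h0 i)
  have hpS := norm_sq_blockAverage_sub_le h0 hsum q x
  have e : extrapolatedPoint β q x - x = extrapolation β q x • (blockAverage β q - x) :=
    add_sub_cancel_left _ _
  rw [e, norm_smul, mul_pow, Real.norm_eq_abs, sq_abs, real_inner_smul_right]
  -- If the average is `x`, no move is made, and `hSz` forces the weighted sum to vanish.
  by_cases hpx : blockAverage β q = x
  · rw [hpx, sub_self, inner_zero_right] at hSz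
    rw [hpx, sub_self, inner_zero_right]
    simpa using hSz
  · have hpos : 0 < ‖blockAverage β q - x‖ ^ 2 := by
      have := norm_pos_iff.2 (sub_ne_zero.2 hpx)
      positivity
    have hL : extrapolation β q x * ‖blockAverage β q - x‖ ^ 2 = ∑ i, β i * ‖q i - x‖ ^ 2 := by
      rw [extrapolation, if_neg hpx, add_zero, add_zero, div_mul_cancel₀ _ hpos.ne']
    have hL1 : 1 ≤ extrapolation β q x := by
      by_contra! h
      nlinarith
    have e2 : extrapolation β q x ^ 2 * ‖blockAverage β q - x‖ ^ 2
        = extrapolation β q x * ∑ i, β i * ‖q i - x‖ ^ 2 := by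
      rw [← hL]
      ring
    rw [e2]
    exact ⟨le_mul_of_one_le_left hS0 hL1, mul_le_mul_of_nonneg_left hSz (by linarith)⟩

theorem relaxedPoint_estimates {M : ℕ} {β : Fin M → ℝ} (h0 : ∀ i, 0 ≤ β i)
    (hsum : ∑ i, β i = 1) {q : Fin M → H} {x z : H}
    (hz : ∀ i, ‖q i - x‖ ^ 2 ≤ ⟪z - x, q i - x⟫) {l : ℝ} (hl0 : 0 ≤ l) (hl1 : l ≤ 1) :
    l ^ 2 * ∑ i, β i * ‖q i - x‖ ^ 2 ≤ ‖relaxedPoint β q l x - x‖ ^ 2 ∧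
      z ∈ haugazeauHalfSpace x (relaxedPoint β q l x) := by
  obtain ⟨h1, h2⟩ := extrapolatedPoint_estimates h0 hsum hz
  have e : relaxedPoint β q l x - x = l • (extrapolatedPoint β q x - x) :=
    add_sub_cancel_left _ _
  have e1 : ‖relaxedPoint β q l x - x‖ ^ 2 = l ^ 2 * ‖extrapolatedPoint β q x - x‖ ^ 2 := by
    rw [e, norm_smul, mul_pow, Real.norm_eq_abs, sq_abs]
  refine ⟨?_, ?_⟩
  · rw [e1]
    exact mul_le_mul_of_nonneg_left h1 (sq_nonneg l)
  · rw [mem_haugazeauHalfSpace]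
    have e2 : z - relaxedPoint β q l x = (z - x) - (relaxedPoint β q l x - x) := by abel
    rw [e2, ← neg_sub (relaxedPoint β q l x) x, inner_neg_right, inner_sub_left,
      real_inner_self_eq_norm_sq, e1, e, real_inner_smul_right]
    -- The inner product is at most `(l ^ 2 - l) * ‖a - x‖ ^ 2`, with `a` the extrapolated point.
    nlinarith [mul_le_mul_of_nonneg_left h2 hl0, mul_nonneg hl0 (sub_nonneg.2 hl1),
      sq_nonneg ‖extrapolatedPoint β q x - x‖]

end BlockStep

/-! ### Weak compactness and the passage from weak to strong convergence. -/

section WeakConvergence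

variable {H : Type*} [NormedAddCommGroup H] [InnerProductSpace ℝ H] [CompleteSpace H]

theorem tendsto_toWeakSpace_iff_inner {α : Type*} {l : Filter α} {u : α → H} {w : H} :
    Tendsto (fun n => toWeakSpace ℝ H (u n)) l (𝓝 (toWeakSpace ℝ H w)) ↔
      ∀ v, Tendsto (fun n => ⟪u n, v⟫) l (𝓝 ⟪w, v⟫) := by
  have hinj : Function.Injective (topDualPairing ℝ H).flip := by
    intro a b hab
    refine ext_inner_left ℝ fun v => ?_
    exact LinearMap.congr_fun hab (InnerProductSpace.toDual ℝ H v)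
  refine (WeakBilin.tendsto_iff_forall_eval_tendsto _ hinj).trans ?_
  constructor
  · intro h v
    have := h (InnerProductSpace.toDual ℝ H v)
    simp_rw [real_inner_comm v]
    exact this
  · intro h f
    have := h ((InnerProductSpace.toDual ℝ H).symm f)
    simp_rw [real_inner_comm ((InnerProductSpace.toDual ℝ H).symm f),
      InnerProductSpace.toDual_symm_apply] at this
    exact this

/-- Bounded sequences of a separable Hilbert space have weakly convergent subsequences. -/
theorem exists_subseq_tendsto_inner [TopologicalSpace.SeparableSpace H] {u : ℕ → H} {R : ℝ}
    (hu : ∀ n, ‖u n‖ ≤ R) :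
    ∃ (w : H) (φ : ℕ → ℕ), StrictMono φ ∧ ∀ v, Tendsto (fun n => ⟪u (φ n), v⟫) atTop (𝓝 ⟪w, v⟫) := by
  -- Sequential Banach–Alaoglu, transported through the Riesz isometry.
  obtain ⟨f, -, φ, hφ, hlim⟩ := WeakDual.isSeqCompact_closedBall ℝ H (0 : StrongDual ℝ H) R
    (x := fun n => StrongDual.toWeakDual (InnerProductSpace.toDual ℝ H (u n)))
    (fun n => by
      refine mem_closedBall_zero_iff.2 ?_
      exact ((InnerProductSpace.toDual ℝ H).norm_map (u n)).trans_le (hu n))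
  refine ⟨(InnerProductSpace.toDual ℝ H).symm (WeakDual.toStrongDual f), φ, hφ, fun v => ?_⟩
  rw [InnerProductSpace.toDual_symm_apply]
  exact tendsto_iff_forall_eval_tendsto_topDualPairing.1 hlim v

/-- A sequence that stays no farther from `a` than the projection of `a` onto `Z`, and whose weak
cluster points lie in `Z`, converges strongly to this projection. -/
theorem tendsto_projOnto_of_weak_cluster [TopologicalSpace.SeparableSpace H] {Z : Set H}
    (hne : Z.Nonempty) (hcl : IsClosed Z) (hconv : Convex ℝ Z) {a : H} {x : ℕ → H}
    (hbound : ∀ n, ‖a - x n‖ ≤ ‖a - projOnto Z a‖)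
    (hweak : ∀ (w : H) (φ : ℕ → ℕ), Tendsto φ atTop atTop →
      (∀ v, Tendsto (fun n => ⟪x (φ n), v⟫) atTop (𝓝 ⟪w, v⟫)) → w ∈ Z) :
    Tendsto x atTop (𝓝 (projOnto Z a)) := by
  have hq := projOnto_spec hne hcl hconv a
  set q := projOnto Z a
  refine tendsto_of_subseq_tendsto fun ns hns => ?_
  have hbd : ∀ n, ‖x (ns n)‖ ≤ ‖a‖ + ‖a - q‖ := fun n => by
    have h1 := norm_sub_norm_le (x (ns n)) a
    rw [norm_sub_rev] at h1
    linarith [hbound (ns n)]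
  obtain ⟨w, φ, hφ, hlim⟩ := exists_subseq_tendsto_inner hbd
  have hw : w ∈ Z := hweak w (fun n => ns (φ n)) (hns.comp hφ.tendsto_atTop) hlim
  have hwq := hq.inner_nonpos hconv hw
  refine ⟨φ, ?_⟩
  have hle : ∀ n, ‖x (ns (φ n)) - q‖ ^ 2
      ≤ 2 * ‖a - q‖ ^ 2 + 2 * (⟪x (ns (φ n)), a - q⟫ - ⟪a, a - q⟫) := fun n => by
    have e : x (ns (φ n)) - q = (a - q) - (a - x (ns (φ n))) := by abel
    have h1 : ‖a - x (ns (φ n))‖ ^ 2 ≤ ‖a - q‖ ^ 2 :=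
      pow_le_pow_left₀ (norm_nonneg _) (hbound _) 2
    rw [e, norm_sub_sq_real, ← inner_sub_left, ← neg_sub a (x _), inner_neg_left,
      real_inner_comm (a - q)]
    linarith
  have hlim2 := (((hlim (a - q)).sub_const ⟪a, a - q⟫).const_mul 2).const_add (2 * ‖a - q‖ ^ 2)
  -- The limit equals `2 * ⟪w - q, a - q⟫`, nonpositive by the variational inequality; it is also a
  -- limit of upper bounds of squares.
  have hL : 2 * ‖a - q‖ ^ 2 + 2 * (⟪w, a - q⟫ - ⟪a, a - q⟫) = 0 := by
    refine le_antisymm ?_ (ge_of_tendsto' hlim2 fun n => (sq_nonneg _).trans (hle n))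
    have e : w - a = (w - q) - (a - q) := by abel
    rw [← inner_sub_left, e, inner_sub_left, real_inner_self_eq_norm_sq,
      real_inner_comm (a - q)]
    linarith
  rw [hL] at hlim2
  have hsq := squeeze_zero (fun n => sq_nonneg ‖x (ns (φ n)) - q‖) hle hlim2
  rw [tendsto_iff_norm_sub_tendsto_zero]
  have := hsq.sqrt
  simpa [Real.sqrt_sq (norm_nonneg _)] using this

end WeakConvergence

/-! ### Deterministic Haugazeau sequences. -/

section HaugazeauSequence

variable {H : Type*} [NormedAddCommGroup H] [InnerProductSpace ℝ H] {Z : Set H} {x r : ℕ → H}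

/-- The variational inequality at the nearest point `x (n + 1)` is the next inclusion. Since `Z`
lies in the intersection, the singleton default in `haugazeauOuter` never occurs. -/
theorem subset_haugazeauHalfSpace_initial [CompleteSpace H] (hne : Z.Nonempty)
    (hZ : ∀ n, Z ⊆ haugazeauHalfSpace (x n) (r n))
    (hx : ∀ n, x (n + 1) = haugazeauQ (x 0) (x n) (r n)) (n : ℕ) :
    Z ⊆ haugazeauHalfSpace (x 0) (x n) := by
  induction n with
  | zero => intro z _; simp [mem_haugazeauHalfSpace]
  | succ n ih =>
    intro z hz
    have hsub := Set.subset_inter ih (hZ n)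
    have h1 := haugazeauQ_mem_inter (hne.mono hsub)
    rw [← hx n] at h1
    rw [mem_haugazeauHalfSpace, real_inner_comm]
    exact h1.inner_nonpos
      ((haugazeauHalfSpace_convex _ _).inter (haugazeauHalfSpace_convex _ _)) (hsub hz)

/-- Pythagoras for a triangle whose angle at `y` is not acute. -/
theorem add_norm_sq_le_of_mem_haugazeauHalfSpace {a y z : H} (h : z ∈ haugazeauHalfSpace a y) :
    ‖a - y‖ ^ 2 + ‖z - y‖ ^ 2 ≤ ‖a - z‖ ^ 2 := by
  rw [mem_haugazeauHalfSpace] at h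
  have e : a - z = (a - y) - (z - y) := by abel
  rw [e, norm_sub_sq_real (a - y), real_inner_comm (z - y)]
  linarith

theorem norm_initial_sub_le [CompleteSpace H]
    (hZ : ∀ n, Z ⊆ haugazeauHalfSpace (x n) (r n))
    (hx : ∀ n, x (n + 1) = haugazeauQ (x 0) (x n) (r n)) {z : H} (hz : z ∈ Z) (n : ℕ) :
    ‖x 0 - x n‖ ≤ ‖x 0 - z‖ := by
  have h1 := add_norm_sq_le_of_mem_haugazeauHalfSpace
    (subset_haugazeauHalfSpace_initial ⟨z, hz⟩ hZ hx n hz)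
  exact le_of_sq_le_sq (by linarith [sq_nonneg ‖z - x n‖]) (norm_nonneg _)

/-- `‖x 0 - x n‖ ^ 2` grows at each step by at least `‖x (n + 1) - x n‖ ^ 2`, which dominates `‖r n
- x n‖ ^ 2` because `x (n + 1)` lies beyond the cut. -/
theorem sum_norm_sq_relaxed_le [CompleteSpace H]
    (hZ : ∀ n, Z ⊆ haugazeauHalfSpace (x n) (r n))
    (hx : ∀ n, x (n + 1) = haugazeauQ (x 0) (x n) (r n)) {z : H} (hz : z ∈ Z) (N : ℕ) :
    ∑ n ∈ Finset.range N, ‖r n - x n‖ ^ 2 ≤ ‖x 0 - z‖ ^ 2 := by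
  have hstep : ∀ N, ∑ n ∈ Finset.range N, ‖r n - x n‖ ^ 2 ≤ ‖x 0 - x N‖ ^ 2 := by
    intro N
    induction N with
    | zero => simp
    | succ N ih =>
      rw [Finset.sum_range_succ]
      have hsub := Set.subset_inter
        (subset_haugazeauHalfSpace_initial ⟨z, hz⟩ hZ hx N) (hZ N)
      have h1 := (haugazeauQ_mem_inter (Set.Nonempty.mono hsub ⟨z, hz⟩)).1
      rw [← hx N] at h1
      have h2 := add_norm_sq_le_of_mem_haugazeauHalfSpace h1.1
      have h3 := add_norm_sq_le_of_mem_haugazeauHalfSpace h1.2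
      rw [norm_sub_rev (x N) (r N), norm_sub_rev (x N) (x (N + 1))] at h3
      linarith [sq_nonneg ‖x (N + 1) - r N‖]
  exact (hstep N).trans (pow_le_pow_left₀ (norm_nonneg _) (norm_initial_sub_le hZ hx hz N) 2)

end HaugazeauSequence

/-! ### Measurability of one iteration. -/

section Measurability

variable {H : Type*} [NormedAddCommGroup H] [InnerProductSpace ℝ H]
  [SecondCountableTopology H] [MeasurableSpace H] [BorelSpace H] {Ω : Type*} [MeasurableSpace Ω]

theorem measurable_haugazeauQ_comp [CompleteSpace H] {x y z : Ω → H} (hx : Measurable x)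
    (hy : Measurable y) (hz : Measurable z) :
    Measurable fun ω => haugazeauQ (x ω) (y ω) (z ω) := by
  simp_rw [haugazeauQ_eq_formula, haugazeauFormula]
  have h1 : Measurable fun ω => ⟪x ω - y ω, y ω - z ω⟫ := (hx.sub hy).inner (hy.sub hz)
  have h2 : Measurable fun ω => ‖x ω - y ω‖ ^ 2 := (hx.sub hy).norm.pow_const 2
  have h3 : Measurable fun ω => ‖y ω - z ω‖ ^ 2 := (hy.sub hz).norm.pow_const 2
  have h4 := (h2.mul h3).sub (h1.pow_const 2)
  refine Measurable.ite (measurableSet_le h4 measurable_const)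
    (Measurable.ite (measurableSet_le measurable_const h1) hz hy)
    (Measurable.ite (measurableSet_le h4 (h1.mul h3)) ?_ ?_)
  · exact hx.sub ((measurable_const.add (h1.div h3)).smul (hy.sub hz))
  · exact hy.add ((h3.div h4).smul ((h1.smul (hx.sub hy)).sub (h2.smul (hy.sub hz))))

open Classical in
theorem measurable_relaxedPoint_comp {M : ℕ} {β : Fin M → Ω → ℝ} {q : Fin M → Ω → H} {l : Ω → ℝ}
    {x : Ω → H} (hβ : ∀ i, Measurable (β i)) (hq : ∀ i, Measurable (q i)) (hl : Measurable l)
    (hx : Measurable x) :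
    Measurable fun ω => relaxedPoint (fun i => β i ω) (fun i => q i ω) (l ω) (x ω) := by
  have hp : Measurable fun ω => blockAverage (fun i => β i ω) (fun i => q i ω) :=
    Finset.measurable_sum _ fun i _ => (hβ i).smul (hq i)
  have hind : Measurable fun ω =>
      if blockAverage (fun i => β i ω) (fun i => q i ω) = x ω then (1 : ℝ) else 0 :=
    Measurable.ite (measurableSet_eq_fun hp hx) measurable_const measurable_const
  have hS : Measurable fun ω => ∑ i, β i ω * ‖q i ω - x ω‖ ^ 2 :=
    Finset.measurable_sum _ fun i _ => (hβ i).mul (((hq i).sub hx).norm.pow_const 2)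
  have hL : Measurable fun ω => extrapolation (fun i => β i ω) (fun i => q i ω) (x ω) := by
    unfold extrapolation
    exact (hS.add hind).div (((hp.sub hx).norm.pow_const 2).add hind)
  unfold relaxedPoint extrapolatedPoint
  exact hx.add (hl.smul ((hx.add (hL.smul (hp.sub hx))).sub hx))

end Measurability

/-! ### The set of almost surely fixed points. -/

section AsFixedPoints

variable {H : Type*} [NormedAddCommGroup H] [InnerProductSpace ℝ H]
  {Ω : Type*} [MeasurableSpace Ω] {P : Measure Ω} {K : Type*} {T : K → H → H}

theorem isClosed_asFixedPoints (hT : ∀ κ, FirmlyQuasinonexpansive (T κ)) (k : Ω → K) :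
    IsClosed (asFixedPoints P T k) := by
  refine IsSeqClosed.isClosed fun u w hu hw => ?_
  filter_upwards [ae_all_iff.2 hu] with ω hω
  exact (hT (k ω)).isClosed_fixedPoints.mem_of_tendsto hw (Eventually.of_forall hω)

theorem convex_asFixedPoints (hT : ∀ κ, FirmlyQuasinonexpansive (T κ)) (k : Ω → K) :
    Convex ℝ (asFixedPoints P T k) := by
  intro u hu v hv a b ha hb hab
  change ∀ᵐ ω ∂P, a • u + b • v ∈ Function.fixedPoints (T (k ω))
  filter_upwards [hu, hv] with ω hω hω'
  exact (hT (k ω)).convex_fixedPoints hω hω' ha hb hab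

/-- Almost surely, all the points of `asFixedPoints P T k` are fixed simultaneously. -/
theorem ae_asFixedPoints_subset [SecondCountableTopology H]
    (hT : ∀ κ, FirmlyQuasinonexpansive (T κ)) (k : Ω → K) :
    ∀ᵐ ω ∂P, asFixedPoints P T k ⊆ Function.fixedPoints (T (k ω)) := by
  -- A countable dense subset leaves countably many null sets; closedness of each fixed point set
  -- recovers the rest.
  obtain ⟨c, hcZ, hc, hZc⟩ := (TopologicalSpace.IsSeparable.of_separableSpace
    (asFixedPoints P T k)).exists_countable_dense_subset
  have hae : ∀ᵐ ω ∂P, ∀ z ∈ c, z ∈ Function.fixedPoints (T (k ω)) :=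
    (ae_ball_iff hc).2 fun z hz => hcZ hz
  filter_upwards [hae] with ω hω
  exact hZc.trans (closure_minimal hω (hT (k ω)).isClosed_fixedPoints)

theorem asFixedPoints_eq_of_identDistrib {E : Type*} [NormedAddCommGroup E]
    [SecondCountableTopology E] [MeasurableSpace E] [BorelSpace E] [MeasurableSpace K]
    {T : K → E → E} (hT : Measurable (fun q : K × E => T q.1 q.2))
    {k k' : Ω → K} (h : IdentDistrib k' k P P) : asFixedPoints P T k' = asFixedPoints P T k := by
  have hmeas : ∀ z, MeasurableSet {κ | z ∈ Function.fixedPoints (T κ)} := fun z =>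
    measurableSet_eq_fun (hT.comp (measurable_id.prodMk measurable_const)) measurable_const
  ext z
  exact ⟨fun hz => h.ae_snd (hmeas z) hz, fun hz => h.symm.ae_snd (hmeas z) hz⟩

end AsFixedPoints

/-! ### Independence and almost sure properties of paths. -/

section RandomPath

/-- If `k' n` is a copy of `k` independent of `x n` and `∑ n, D (k' n, x n)` has a finite
expectation, then `∑ n, D (κ, x n ω)` is finite for almost every `ω` and almost every value
`κ` of `k`. -/
theorem ae_ae_tsum_lt_top_of_indepFun {Ω K E : Type*} [MeasurableSpace Ω] [MeasurableSpace K]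
    [MeasurableSpace E] {P : Measure Ω} [IsProbabilityMeasure P] {k : Ω → K} (hk : Measurable k)
    {k' : ℕ → Ω → K} (hk' : ∀ n, Measurable (k' n)) (hcopy : ∀ n, IdentDistrib (k' n) k P P)
    {x : ℕ → Ω → E} (hx : ∀ n, Measurable (x n)) (hind : ∀ n, IndepFun (k' n) (x n) P)
    {D : K × E → ℝ≥0∞} (hD : Measurable D)
    (hfin : ∫⁻ ω, ∑' n, D (k' n ω, x n ω) ∂P ≠ ∞) :
    ∀ᵐ ω ∂P, ∀ᵐ ω' ∂P, ∑' n, D (k ω', x n ω) < ∞ := by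
  have hDx : ∀ n, Measurable fun q : Ω × Ω => D (k q.2, x n q.1) := fun n =>
    hD.comp ((hk.comp measurable_snd).prodMk ((hx n).comp measurable_fst))
  -- By independence the joint law of `(k' n, x n)` is the product of the laws of `k` and `x n`;
  -- Tonelli then applies.
  have hterm : ∀ n, ∫⁻ ω, D (k' n ω, x n ω) ∂P = ∫⁻ ω, ∫⁻ ω', D (k ω', x n ω) ∂P ∂P := by
    intro n
    have : IsProbabilityMeasure (P.map (x n)) :=
      Measure.isProbabilityMeasure_map (hx n).aemeasurable
    have : IsProbabilityMeasure (P.map k) := Measure.isProbabilityMeasure_map hk.aemeasurable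
    rw [← lintegral_map hD ((hk' n).prodMk (hx n)),
      (indepFun_iff_map_prod_eq_prod_map_map (hk' n).aemeasurable (hx n).aemeasurable).1 (hind n),
      (hcopy n).map_eq, lintegral_prod_symm _ hD.aemeasurable,
      lintegral_map hD.lintegral_prod_left' (hx n)]
    refine lintegral_congr fun ω => ?_
    exact lintegral_map (hD.comp (measurable_id.prodMk measurable_const)) hk
  have hsum : ∫⁻ ω, ∫⁻ ω', ∑' n, D (k ω', x n ω) ∂P ∂P ≠ ∞ := by
    rw [lintegral_tsum (f := fun n ω => D (k' n ω, x n ω))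
      fun n => (hD.comp ((hk' n).prodMk (hx n))).aemeasurable] at hfin
    simp_rw [hterm] at hfin
    rw [← lintegral_tsum fun n => (hDx n).lintegral_prod_right'.aemeasurable] at hfin
    convert! hfin using 3 with ω
    exact lintegral_tsum fun n =>
      (hD.comp (hk.prodMk measurable_const)).aemeasurable
  have hmeas : Measurable fun q : Ω × Ω => ∑' n, D (k q.2, x n q.1) := Measurable.tsum hDx
  filter_upwards [ae_lt_top hmeas.lintegral_prod_right' hsum] with ω hω
  exact ae_lt_top (hmeas.comp measurable_prodMk_left) hω.ne

variable {Ω K H : Type*} [MeasurableSpace Ω] {P : Measure Ω} [MeasurableSpace K]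
  [NormedAddCommGroup H] [InnerProductSpace ℝ H] [MeasurableSpace H] {T : K → H → H} {k : Ω → K} {M : ℕ} {δ ε : ℝ} {kk : ℕ → Fin M → Ω → K}
  {β : ℕ → Fin M → Ω → ℝ} {lam : ℕ → Ω → ℝ} {x : ℕ → Ω → H}

/-- The recursion holds only almost surely; completeness of `P` upgrades a.e. measurability to
measurability. -/
theorem IsBlockHaugazeau.measurable_iterate [SecondCountableTopology H] [BorelSpace H]
    [CompleteSpace H] [P.IsComplete]
    (halg : IsBlockHaugazeau P T k M δ ε kk β lam x)
    (hT : Measurable (fun q : K × H => T q.1 q.2)) (hx0 : Measurable (x 0)) (n : ℕ) :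
    Measurable (x n) := by
  induction n with
  | zero => exact hx0
  | succ n ih =>
    refine aemeasurable_iff_measurable.1 (AEMeasurable.congr ?_ (EventuallyEq.symm (halg.update n)))
    exact (measurable_haugazeauQ_comp hx0 ih (measurable_relaxedPoint_comp (halg.weight_measurable n)
      (fun i => hT.comp ((halg.index_measurable n i).prodMk ih)) (halg.relax_measurable n)
      ih)).aemeasurable

theorem IsBlockHaugazeau.indepFun (halg : IsBlockHaugazeau P T k M δ ε kk β lam x) (n : ℕ)
    (i : Fin M) : IndepFun (kk n i) (x n) P := by
  rw [IndepFun_iff_Indep]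
  exact indep_of_indep_of_le_right (halg.index_indep n i) (le_iSup₂_of_le n le_rfl le_rfl)

/-- The properties of the paths of the algorithm that hold almost surely. -/
theorem IsBlockHaugazeau.ae_step [SecondCountableTopology H] [BorelSpace H]
    (halg : IsBlockHaugazeau P T k M δ ε kk β lam x)
    (hfirm : ∀ κ, FirmlyQuasinonexpansive (T κ)) (hT : Measurable (fun q : K × H => T q.1 q.2))
    (hδ : 0 < δ) (hε : 0 < ε) (hZ : (asFixedPoints P T k).Nonempty) :
    ∀ᵐ ω ∂P, ∃ r : ℕ → H, ∀ n, asFixedPoints P T k ⊆ haugazeauHalfSpace (x n ω) (r n) ∧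
      x (n + 1) ω = haugazeauQ (x 0 ω) (x n ω) (r n) ∧
      ∀ i, δ * ε ^ 2 * ‖T (kk n i ω) (x n ω) - x n ω‖ ^ 2 ≤ ‖r n - x n ω‖ ^ 2 := by
  have hfix : ∀ᵐ ω ∂P, ∀ n i, asFixedPoints P T k ⊆ Function.fixedPoints (T (kk n i ω)) := by
    rw [ae_all_iff]
    intro n
    rw [ae_all_iff]
    intro i
    rw [← asFixedPoints_eq_of_identDistrib hT (halg.index_copy n i)]
    exact ae_asFixedPoints_subset hfirm _
  obtain ⟨z₀, hz₀⟩ := hZ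
  filter_upwards [hfix, ae_all_iff.2 fun n => ae_all_iff.2 (halg.weight_mem n),
    ae_all_iff.2 halg.weight_sum, ae_all_iff.2 fun n => ae_all_iff.2 (halg.weight_ge n),
    ae_all_iff.2 halg.relax_mem, ae_all_iff.2 halg.update] with ω h1 h2 h3 h4 h5 h6
  refine ⟨_, fun n => ⟨fun z hz => ?_, h6 n, fun i => ?_⟩⟩
  · exact (relaxedPoint_estimates (fun i => (h2 n i).1) (h3 n)
      (fun i => (hfirm _).norm_sq_le_inner (h1 n i hz) _) (hε.le.trans (h5 n).1) (h5 n).2).2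
  · have hr := (relaxedPoint_estimates (fun i => (h2 n i).1) (h3 n)
      (fun i => (hfirm _).norm_sq_le_inner (h1 n i hz₀) (x n ω)) (hε.le.trans (h5 n).1) (h5 n).2).1
    refine le_trans ?_ hr
    have : Nonempty (Fin M) := ⟨i⟩
    -- An index of largest displacement has weight at least `δ`, so its single term controls every
    -- displacement in the block.
    obtain ⟨m, hm⟩ := Finite.exists_max fun j => ‖T (kk n j ω) (x n ω) - x n ω‖
    have hS : δ * ‖T (kk n i ω) (x n ω) - x n ω‖ ^ 2
        ≤ ∑ j, β n j ω * ‖T (kk n j ω) (x n ω) - x n ω‖ ^ 2 := by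
      refine le_trans ?_ (Finset.single_le_sum (f := fun j =>
        β n j ω * ‖T (kk n j ω) (x n ω) - x n ω‖ ^ 2)
        (fun j _ => mul_nonneg (h2 n j).1 (sq_nonneg _)) (Finset.mem_univ m))
      exact mul_le_mul (h4 n m hm) (pow_le_pow_left₀ (norm_nonneg _) (hm i) 2) (sq_nonneg _)
        (h2 n m).1
    have hl : ε ^ 2 ≤ lam n ω ^ 2 := pow_le_pow_left₀ hε.le (h5 n).1 2
    calc δ * ε ^ 2 * ‖T (kk n i ω) (x n ω) - x n ω‖ ^ 2
        = ε ^ 2 * (δ * ‖T (kk n i ω) (x n ω) - x n ω‖ ^ 2) := by ring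
      _ ≤ _ := mul_le_mul hl hS (by positivity) (sq_nonneg _)

end RandomPath

/-! ### Dominated convergence in `L²`. -/

section DominatedConvergence

theorem tendsto_eLpNorm_two_of_dominated {Ω E : Type*} [MeasurableSpace Ω] {P : Measure Ω}
    [NormedAddCommGroup E] {f : ℕ → Ω → E} {g : Ω → ℝ} (hf : ∀ n, AEStronglyMeasurable (f n) P)
    (hg : MemLp g 2 P) (hbound : ∀ n, ∀ᵐ ω ∂P, ‖f n ω‖ ≤ g ω)
    (hlim : ∀ᵐ ω ∂P, Tendsto (fun n => f n ω) atTop (𝓝 0)) :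
    Tendsto (fun n => eLpNorm (f n) 2 P) atTop (𝓝 0) := by
  have hG : ∫⁻ ω, ‖g ω‖ₑ ^ (2 : ℝ) ∂P ≠ ∞ := by
    have := lintegral_rpow_enorm_lt_top_of_eLpNorm_lt_top (by norm_num) (by norm_num) hg.2
    simpa using this.ne
  have h := tendsto_lintegral_of_dominated_convergence' (μ := P)
    (F := fun n ω => ‖f n ω‖ₑ ^ (2 : ℝ)) (f := fun _ => 0) (fun ω => ‖g ω‖ₑ ^ (2 : ℝ))
    (fun n => (hf n).enorm.pow_const _)
    (fun n => by
      filter_upwards [hbound n] with ω hω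
      refine ENNReal.rpow_le_rpow ?_ (by norm_num)
      rw [enorm_le_iff_norm_le]
      exact hω.trans (le_abs_self _))
    hG
    (by
      filter_upwards [hlim] with ω hω
      have h1 := hω.enorm
      rw [enorm_zero] at h1
      have h2 := (ENNReal.continuous_rpow_const (y := 2)).tendsto 0 |>.comp h1
      rw [ENNReal.zero_rpow_of_pos two_pos] at h2
      exact h2)
  rw [lintegral_zero] at h
  have h2 := (ENNReal.continuous_rpow_const (y := 1 / 2)).tendsto 0 |>.comp h
  rw [ENNReal.zero_rpow_of_pos (by norm_num)] at h2
  refine h2.congr fun n => ?_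
  rw [eLpNorm_eq_lintegral_rpow_enorm_toReal (by norm_num) (by norm_num)]
  simp

end DominatedConvergence

theorem theorem2
    {H : Type*} [NormedAddCommGroup H] [InnerProductSpace ℝ H] [CompleteSpace H]
    [TopologicalSpace.SeparableSpace H] [MeasurableSpace H] [BorelSpace H]
    {Ω : Type*} [MeasurableSpace Ω] (P : Measure Ω) [IsProbabilityMeasure P] [P.IsComplete]
    {K : Type*} [MeasurableSpace K]
    (T : K → H → H)
    (hT_firm : ∀ κ, FirmlyQuasinonexpansive (T κ))
    (hT_meas : Measurable (fun q : K × H => T q.1 q.2))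
    (hT_demi : ∀ κ, DemiclosedAt (fun v => v - T κ v) 0)
    (k : Ω → K) (hk : Measurable k)
    (hZ : (asFixedPoints P T k).Nonempty)
    (M : ℕ) (hM : 0 < M)
    (δ : ℝ) (hδ : δ ∈ Set.Ioo (0 : ℝ) (1 / (M : ℝ)))
    (ε : ℝ) (hε : ε ∈ Set.Ioo (0 : ℝ) 1)
    (kk : ℕ → Fin M → Ω → K) (β : ℕ → Fin M → Ω → ℝ) (lam : ℕ → Ω → ℝ)
    (x : ℕ → Ω → H)
    (hx0 : Measurable (x 0)) (hx0_L2 : MemLp (x 0) 2 P)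
    (halg : IsBlockHaugazeau P T k M δ ε kk β lam x) :
    -- the projection onto `Z` is well defined
    (IsClosed (asFixedPoints P T k) ∧ Convex ℝ (asFixedPoints P T k)) ∧
    -- strong convergence almost surely
    (∀ᵐ ω ∂P, Tendsto (fun n => x n ω) atTop
      (𝓝 (projOnto (asFixedPoints P T k) (x 0 ω)))) ∧
    -- strong convergence in `L²`
    (∀ n, MemLp (x n) 2 P) ∧
    MemLp (fun ω => projOnto (asFixedPoints P T k) (x 0 ω)) 2 P ∧
    Tendsto (fun n => eLpNorm (fun ω => x n ω - projOnto (asFixedPoints P T k) (x 0 ω)) 2 P)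
      atTop (𝓝 0) := by
  have : SecondCountableTopology H := UniformSpace.secondCountable_of_separable H
  set Z := asFixedPoints P T k with hZdef
  have hcl : IsClosed Z := isClosed_asFixedPoints hT_firm k
  have hconv : Convex ℝ Z := convex_asFixedPoints hT_firm k
  have hproj := projOnto_spec hZ hcl hconv
  obtain ⟨z, hz⟩ := id hZ
  obtain ⟨hδ0, -⟩ := hδ
  obtain ⟨hε0, -⟩ := hε
  have hxm := halg.measurable_iterate hT_meas hx0
  have hstep := halg.ae_step hT_firm hT_meas hδ0 hε0 hZ
  have hbound : ∀ᵐ ω ∂P, ∀ y ∈ Z, ∀ n, ‖x 0 ω - x n ω‖ ≤ ‖x 0 ω - y‖ := by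
    filter_upwards [hstep] with ω ⟨r, hr⟩ y hy n
    exact norm_initial_sub_le (x := fun n => x n ω) (fun n => (hr n).1) (fun n => (hr n).2.1) hy n
  have hdist : MemLp (fun ω => x 0 ω - z) 2 P := hx0_L2.sub (memLp_const z)
  have hqm : Measurable fun ω => projOnto Z (x 0 ω) :=
    (lipschitzWith_projOnto hZ hcl hconv).continuous.measurable.comp hx0
  have hsub_n : ∀ n, MemLp (fun ω => x 0 ω - x n ω) 2 P := fun n =>
    hdist.mono (hx0.sub (hxm n)).aestronglyMeasurable (by
      filter_upwards [hbound] with ω hω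
      exact hω z hz n)
  have hsub_q : MemLp (fun ω => x 0 ω - projOnto Z (x 0 ω)) 2 P :=
    hdist.mono (hx0.sub hqm).aestronglyMeasurable (Eventually.of_forall fun ω =>
      (hproj (x 0 ω)).2 z hz)
  have hasum : ∀ᵐ ω ∂P, ∀ᵐ ω' ∂P,
      ∑' n, ENNReal.ofReal (‖T (k ω') (x n ω) - x n ω‖ ^ 2) < ∞ := by
    -- One index per block suffices, since the cut controls every displacement.
    let i : Fin M := ⟨0, hM⟩
    refine ae_ae_tsum_lt_top_of_indepFun hk (fun n => halg.index_measurable n i)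
      (fun n => halg.index_copy n i) hxm (fun n => halg.indepFun n i)
      (D := fun q => ENNReal.ofReal (‖T q.1 q.2 - q.2‖ ^ 2))
      ((hT_meas.sub measurable_snd).norm.pow_const 2).ennreal_ofReal ?_
    have hint : Integrable (fun ω => (δ * ε ^ 2)⁻¹ * ‖x 0 ω - z‖ ^ 2) P :=
      hdist.norm.integrable_sq.const_mul _
    refine ne_top_of_le_ne_top hint.lintegral_lt_top.ne (lintegral_mono_ae ?_)
    filter_upwards [hstep] with ω ⟨r, hr⟩
    refine ENNReal.tsum_le_of_sum_range_le fun N => ?_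
    rw [← ENNReal.ofReal_sum_of_nonneg fun _ _ => sq_nonneg _]
    refine ENNReal.ofReal_le_ofReal ?_
    have hc : 0 < δ * ε ^ 2 := by positivity
    rw [← div_eq_inv_mul, le_div_iff₀' hc, Finset.mul_sum]
    exact (Finset.sum_le_sum fun n _ => (hr n).2.2 i).trans
      (sum_norm_sq_relaxed_le (x := fun n => x n ω) (fun n => (hr n).1) (fun n => (hr n).2.1) hz N)
  have hlim : ∀ᵐ ω ∂P, Tendsto (fun n => x n ω) atTop (𝓝 (projOnto Z (x 0 ω))) := by
    filter_upwards [hbound, hasum] with ω hω hsum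
    refine tendsto_projOnto_of_weak_cluster hZ hcl hconv (hω _ (hproj (x 0 ω)).1)
      fun w φ hφ hw => ?_
    rw [hZdef]
    -- The exceptional set of `ω'` depends on the path only, not on the subsequence or on `w`.
    filter_upwards [hsum] with ω' hω'
    have h1 := ENNReal.tendsto_atTop_zero_of_tsum_ne_top hω'.ne
    have h2 := (ENNReal.tendsto_toReal ENNReal.zero_ne_top).comp h1
    have h3 : Tendsto (fun n => x n ω - T (k ω') (x n ω)) atTop (𝓝 0) := by
      rw [tendsto_zero_iff_norm_tendsto_zero]
      have h4 := h2.sqrt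
      refine (h4.congr fun n => ?_).trans (by simp)
      simp [Real.sqrt_sq (norm_nonneg _), norm_sub_rev]
    exact (sub_eq_zero.1 (hT_demi (k ω') w (fun n => x (φ n) ω)
      (tendsto_toWeakSpace_iff_inner.2 hw) (h3.comp hφ))).symm
  refine ⟨⟨hcl, hconv⟩, hlim, fun n => ?_, ?_, ?_⟩
  · convert! hx0_L2.sub (hsub_n n) using 1
    ext ω
    simp
  · convert! hx0_L2.sub hsub_q using 1
    ext ω
    simp
  · refine tendsto_eLpNorm_two_of_dominated (g := fun ω => 2 * ‖x 0 ω - projOnto Z (x 0 ω)‖)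
      (fun n => ((hxm n).sub hqm).aestronglyMeasurable) (hsub_q.norm.const_mul 2) (fun n => ?_) ?_
    · filter_upwards [hbound] with ω hω
      have h1 := hω _ (hproj (x 0 ω)).1 n
      have h2 := norm_sub_le_norm_sub_add_norm_sub (x n ω) (x 0 ω) (projOnto Z (x 0 ω))
      rw [norm_sub_rev (x n ω) (x 0 ω)] at h2
      linarith
    · filter_upwards [hlim] with ω hω
      exact tendsto_sub_nhds_zero_iff.2 hω
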